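/- Let $m\ge 0$ be an integer. For $x\in\mathbb Z$ put $t_m(x)=\frac{x^2+mx}{2}$; the numbers $t_m(x)$, $x\in\mathbb Z$, are called the $m$-triangular numbers. For an integer $n\ge 0$ let $r_{m,4}(n)$ be the number of $(x,y,z,w)\in\mathbb Z^4$ with $$n=\frac{x^2+mx}{2}+\frac{y^2+my}{2}+\frac{z^2+mz}{2}+\frac{w^2+mw}{2},$$ and let $\widetilde r_{m,4}(n)$ be the number of ordered quadruples $(T_1,T_2,T_3,T_4)$ of $m$-triangular numbers with $n=T_1+T_2+T_3+T_4$. Let $r_4(N)$ be the number of $(x,y,z,w)\in\mathbb Z^4$ with $x^2+y^2+z^2+w^2=N$, and let $\sigma_1(N)=\sum_{d\mid N}d$. Then, for all integers $n\ge 0$ and $p\ge 0$: i) If $m=2p$, then $$r_{2p,4}(n)=r_4(2n+4p^2),$$ where $r_4(0)=1$, $r_4(N)=8\sum_{d\mid N}d$ for all odd $N\ge 1$, and $r_4(N)=24\sum_{d\mid N,\ d\equiv 1\,(2)}d$ for all even $N\ge 2$. ii) If $m=2p+1$, then $$\widetilde r_{2p+1,4}(n)=\sigma_1\bigl(2n+4p(p+1)+1\bigr),\qquad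 r_{2p+1,4}(n)=16\,\sigma_1\bigl(2n+4p(p+1)+1\bigr).$$ -/

import Mathlib

/-- The `m`-triangular number `t_m(x) = (x² + m x) / 2`, with `x` an integer.
It is a rational number: for even `m` and odd `x` it is a half-integer. -/
def mTriangular (m : ℕ) (x : ℤ) : ℚ := ((x : ℚ) ^ 2 + (m : ℚ) * (x : ℚ)) / 2

/-- `r_{m,N}(n)`: the number of `(x_1, …, x_N) ∈ ℤ^N` with `n = t_m(x_1) + ⋯ + t_m(x_N)`. -/
noncomputable def triangularReps (m N n : ℕ) : ℕ :=
  {x : Fin N → ℤ | ∑ k, mTriangular m (x k) = (n : ℚ)}.ncard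

/-- The number of ordered `N`-tuples `(T_1, …, T_N)` of `m`-triangular numbers
(that is, of members of `{t_m(x) : x ∈ ℤ}`) with `n = T_1 + ⋯ + T_N`. -/
noncomputable def triangularValueReps (m N n : ℕ) : ℕ :=
  {T : Fin N → ℚ | (∀ k, T k ∈ Set.range (mTriangular m)) ∧ ∑ k, T k = (n : ℚ)}.ncard

/-- `r_N(n)`: the number of `(x_1, …, x_N) ∈ ℤ^N` with `n = x_1² + ⋯ + x_N²`. -/
noncomputable def squareReps (N n : ℕ) : ℕ :=
  {x : Fin N → ℤ | ∑ k, x k ^ 2 = (n : ℤ)}.ncard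

/-!
By completing the square, the representations by `m`-triangular numbers become representations by
four squares: of `2 n + 4 p²` for `m = 2 p`, and of `4 (2 n + 4 p (p + 1) + 1)` by odd squares for
`m = 2 p + 1`. Everything then follows from Jacobi's four-square theorem (`squareReps_four`). For
odd `N`, a representation of `4 N` has all terms even or all terms odd, so `r₄(4 N) - r₄(N)` counts
the representations by odd squares (`ncard_odd_four_squares`); and for odd `m` each `m`-triangular
number has exactly two arguments, which accounts for the factor `16 = 2 ^ 4`.

Jacobi's theorem is proved by a recurrence. Counting representations of `n` by five squares and
using that the five coordinates are interchangeable gives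
`∑ i, (n - 5 i²) r₄(n - i²) = 0` (`card_squareTuples_recurrence`). This determines `r₄` from
`r₄(0) = 1`, so it is enough that the divisor sum `8 ∑_{d e = k} ε(d, e) d`, where `ε = -1` on pairs
of even integers and `ε = 1` elsewhere, obeys the same recurrence
(`fourSquareDivisorSum_recurrence`). Expanded, this is a statement about the sum of
`ε(d, e) (d e - 4 i²) d` over the solutions of `i² + d e = n` with `d, e > 0`. It comes from a
Liouville identity (`liouville_identity`), obtained by cutting the set of solutions along the
automorph `(i, d, e) ↦ (i + d, d, e - 2 i - d)` of the form `i² + d e`, applied to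
`F = ε(d, e) i (d² - e²)`. The boundary terms of the identity are present only when `n` is a square,
where they match the term `r₄(0)` of the recurrence.
-/

/-! ### A Liouville identity for `i² + d e = n` -/

open Finset in
/-- The ordered factorisations `k = d e` into positive integers. -/
noncomputable def factorPairs (k : ℤ) : Finset (ℤ × ℤ) :=
  (Icc 1 k ×ˢ Icc 1 k).filter fun p => p.1 * p.2 = k

/-- The triples `(i, d, e)` with `i² + d e = n` and `d, e > 0`, grouped by `i`. -/
noncomputable def liouvilleTriples (n : ℤ) : Finset (Σ _ : ℤ, ℤ × ℤ) :=
  (Finset.Icc (-n) n).sigma fun i => factorPairs (n - i ^ 2)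

theorem mem_factorPairs {k : ℤ} {p : ℤ × ℤ} :
    p ∈ factorPairs k ↔ 0 < p.1 ∧ 0 < p.2 ∧ p.1 * p.2 = k := by
  simp only [factorPairs, Finset.mem_filter, Finset.mem_product, Finset.mem_Icc]
  constructor
  · rintro ⟨⟨⟨h1, -⟩, h2, -⟩, h⟩
    exact ⟨h1, h2, h⟩
  · rintro ⟨h1, h2, h⟩
    refine ⟨⟨⟨h1, ?_⟩, h2, ?_⟩, h⟩ <;> nlinarith

theorem mem_Icc_neg_self_of_sq_le {n i : ℤ} (h : i ^ 2 ≤ n) : i ∈ Finset.Icc (-n) n := by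
  rw [Finset.mem_Icc]
  have h1 := Int.le_self_sq i
  have h2 := Int.le_self_sq (-i)
  constructor <;> nlinarith

theorem mem_liouvilleTriples {n : ℤ} {v : Σ _ : ℤ, ℤ × ℤ} :
    v ∈ liouvilleTriples n ↔
      0 < v.2.1 ∧ 0 < v.2.2 ∧ v.1 ^ 2 + v.2.1 * v.2.2 = n := by
  rw [liouvilleTriples, Finset.mem_sigma, mem_factorPairs]
  constructor
  · rintro ⟨-, h1, h2, h⟩
    exact ⟨h1, h2, by linarith⟩
  · rintro ⟨h1, h2, h⟩
    exact ⟨mem_Icc_neg_self_of_sq_le (by nlinarith), h1, h2, by linarith⟩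

/-- A Liouville identity: the map `(i, d, e) ↦ (i + d, d, e - 2i - d)` preserves `i² + d e`, and
the sum of an odd function `F` invariant under `(i, d, e) ↦ (-i, e, d)` along it can be compared
with the sum of `F` itself, up to terms that occur only when `n` is a square. -/
theorem liouville_identity (n : ℤ) (F : ℤ → ℤ → ℤ → ℤ)
    (hodd : ∀ i d e, F (-i) (-d) (-e) = -F i d e) (hswap : ∀ i d e, F (-i) e d = F i d e) :
    2 * ∑ v ∈ liouvilleTriples n, F (v.1 + v.2.1) v.2.1 (v.2.2 - 2 * v.1 - v.2.1) =
      ∑ v ∈ liouvilleTriples n, F v.1 v.2.1 v.2.2 +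
      2 * ∑ v ∈ liouvilleTriples n with v.2.2 = 2 * v.1 + v.2.1, F (v.1 + v.2.1) v.2.1 0 -
      ∑ v ∈ liouvilleTriples n with v.2.1 = v.2.2 + 2 * v.1, F v.1 v.2.1 v.2.2 := by
  set S := liouvilleTriples n with hS
  set G : (Σ _ : ℤ, ℤ × ℤ) → ℤ :=
    fun v => F (v.1 + v.2.1) v.2.1 (v.2.2 - 2 * v.1 - v.2.1) with hG
  -- An involution cancels the triples whose image has a negative last coordinate.
  have hneg : ∑ v ∈ S with v.2.2 < 2 * v.1 + v.2.1, G v = 0 := by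
    have h : ∑ v ∈ S with v.2.2 < 2 * v.1 + v.2.1, G v =
        ∑ v ∈ S with v.2.2 < 2 * v.1 + v.2.1, -G v := by
      refine Finset.sum_nbij' (fun v => ⟨v.2.2 - v.1, 2 * v.1 + v.2.1 - v.2.2, v.2.2⟩)
        (fun v => ⟨v.2.2 - v.1, 2 * v.1 + v.2.1 - v.2.2, v.2.2⟩) ?_ ?_ ?_ ?_ ?_
      · rintro ⟨i, d, e⟩ h
        simp only [Finset.mem_filter, hS, mem_liouvilleTriples] at h ⊢
        obtain ⟨⟨h1, h2, h3⟩, h4⟩ := h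
        exact ⟨⟨by linarith, h2, by linarith⟩, by linarith⟩
      · rintro ⟨i, d, e⟩ h
        simp only [Finset.mem_filter, hS, mem_liouvilleTriples] at h ⊢
        obtain ⟨⟨h1, h2, h3⟩, h4⟩ := h
        exact ⟨⟨by linarith, h2, by linarith⟩, by linarith⟩
      · rintro ⟨i, d, e⟩ -
        simp only [Sigma.mk.injEq, heq_eq_eq, Prod.mk.injEq]
        exact ⟨by ring, by ring, trivial⟩
      · rintro ⟨i, d, e⟩ -
        simp only [Sigma.mk.injEq, heq_eq_eq, Prod.mk.injEq]
        exact ⟨by ring, by ring, trivial⟩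
      · rintro ⟨i, d, e⟩ -
        simp only [hG]
        rw [← hodd, ← hswap]
        congr 1 <;> ring
    rw [Finset.sum_neg_distrib] at h
    linarith
  have hpos : ∑ v ∈ S with 2 * v.1 + v.2.1 < v.2.2, G v =
      ∑ v ∈ S with v.2.1 < v.2.2 + 2 * v.1, F v.1 v.2.1 v.2.2 := by
    refine Finset.sum_nbij' (fun v => ⟨v.1 + v.2.1, v.2.1, v.2.2 - 2 * v.1 - v.2.1⟩)
        (fun v => ⟨v.1 - v.2.1, v.2.1, v.2.2 + 2 * v.1 - v.2.1⟩) ?_ ?_ ?_ ?_ ?_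
    · rintro ⟨i, d, e⟩ h
      simp only [Finset.mem_filter, hS, mem_liouvilleTriples] at h ⊢
      obtain ⟨⟨h1, h2, h3⟩, h4⟩ := h
      exact ⟨⟨by linarith, by linarith, by linarith⟩, by linarith⟩
    · rintro ⟨i, d, e⟩ h
      simp only [Finset.mem_filter, hS, mem_liouvilleTriples] at h ⊢
      obtain ⟨⟨h1, h2, h3⟩, h4⟩ := h
      exact ⟨⟨by linarith, by linarith, by linarith⟩, by linarith⟩
    · rintro ⟨i, d, e⟩ -
      simp only [Sigma.mk.injEq, heq_eq_eq, Prod.mk.injEq]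
      exact ⟨by ring, trivial, by ring⟩
    · rintro ⟨i, d, e⟩ -
      simp only [Sigma.mk.injEq, heq_eq_eq, Prod.mk.injEq]
      exact ⟨by ring, trivial, by ring⟩
    · rintro ⟨i, d, e⟩ -
      rfl
  have hhalf : ∑ v ∈ S with v.2.2 + 2 * v.1 < v.2.1, F v.1 v.2.1 v.2.2 =
      ∑ v ∈ S with v.2.1 < v.2.2 + 2 * v.1, F v.1 v.2.1 v.2.2 := by
    refine Finset.sum_nbij' (fun v => ⟨-v.1, v.2.2, v.2.1⟩)
        (fun v => ⟨-v.1, v.2.2, v.2.1⟩) ?_ ?_ ?_ ?_ ?_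
    · rintro ⟨i, d, e⟩ h
      simp only [Finset.mem_filter, hS, mem_liouvilleTriples] at h ⊢
      obtain ⟨⟨h1, h2, h3⟩, h4⟩ := h
      exact ⟨⟨by linarith, by linarith, by linarith⟩, by linarith⟩
    · rintro ⟨i, d, e⟩ h
      simp only [Finset.mem_filter, hS, mem_liouvilleTriples] at h ⊢
      obtain ⟨⟨h1, h2, h3⟩, h4⟩ := h
      exact ⟨⟨by linarith, by linarith, by linarith⟩, by linarith⟩
    · rintro ⟨i, d, e⟩ -
      simp
    · rintro ⟨i, d, e⟩ -
      simp
    · rintro ⟨i, d, e⟩ -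
      exact (hswap _ _ _).symm
  have split : ∀ (g a b : (Σ _ : ℤ, ℤ × ℤ) → ℤ), ∑ v ∈ S, g v =
      ∑ v ∈ S with a v < b v, g v + ∑ v ∈ S with a v = b v, g v +
        ∑ v ∈ S with b v < a v, g v := by
    intro g a b
    simp only [Finset.sum_filter, ← Finset.sum_add_distrib]
    refine Finset.sum_congr rfl fun v _ => ?_
    rcases lt_trichotomy (a v) (b v) with h | h | h
    · simp [h, h.ne, h.not_gt]
    · simp [h]
    · simp [h, h.ne', h.not_gt]
  have e1 := split G (fun v => v.2.2) (fun v => 2 * v.1 + v.2.1)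
  have e2 := split (fun v => F v.1 v.2.1 v.2.2) (fun v => v.2.1) (fun v => v.2.2 + 2 * v.1)
  have e3 : ∑ v ∈ S with v.2.2 = 2 * v.1 + v.2.1, G v =
      ∑ v ∈ S with v.2.2 = 2 * v.1 + v.2.1, F (v.1 + v.2.1) v.2.1 0 := by
    refine Finset.sum_congr rfl fun v hv => ?_
    simp only [hG, (Finset.mem_filter.mp hv).2]
    congr 1; ring
  linarith

/-! ### The weighted sum of `(d e - 4 i²) d` -/

/-- The sign `-1` on pairs of even integers and `1` elsewhere. It makes
`8 ∑_{d e = k} evenSign d e * d` the number of representations of `k > 0` by four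
squares. -/
def evenSign (d e : ℤ) : ℤ := if Even d ∧ Even e then -1 else 1

theorem evenSign_comm (d e : ℤ) : evenSign d e = evenSign e d := by
  simp only [evenSign, and_comm]

theorem evenSign_neg (d e : ℤ) : evenSign (-d) (-e) = evenSign d e := by
  simp only [evenSign, even_neg]

theorem evenSign_sub (i d e : ℤ) : evenSign d (e - 2 * i - d) = evenSign d e := by
  have h : (Even d ∧ Even (e - 2 * i - d)) ↔ (Even d ∧ Even e) := by
    simp only [Int.even_sub, Int.even_mul, even_two, true_or]
    tauto
  simp only [evenSign, h]

/-- Sums over the Liouville triples are invariant under `i ↦ -i` and `d ↔ e`. -/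
theorem sum_liouvilleTriples_symm (n : ℤ) (g : ℤ → ℤ → ℤ → ℤ) :
    ∑ v ∈ liouvilleTriples n, g (-v.1) v.2.1 v.2.2 = ∑ v ∈ liouvilleTriples n, g v.1 v.2.1 v.2.2 ∧
    ∑ v ∈ liouvilleTriples n, g v.1 v.2.2 v.2.1 =
      ∑ v ∈ liouvilleTriples n, g v.1 v.2.1 v.2.2 := by
  constructor
  · refine Finset.sum_nbij' (fun v => ⟨-v.1, v.2.1, v.2.2⟩) (fun v => ⟨-v.1, v.2.1, v.2.2⟩)
      ?_ ?_ ?_ ?_ ?_ <;> rintro ⟨i, d, e⟩ <;> simp [mem_liouvilleTriples]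
  · refine Finset.sum_nbij' (fun v => ⟨v.1, v.2.2, v.2.1⟩) (fun v => ⟨v.1, v.2.2, v.2.1⟩)
      ?_ ?_ ?_ ?_ ?_ <;> rintro ⟨i, d, e⟩ <;> simp [mem_liouvilleTriples, mul_comm e d] <;> tauto

/-- The Liouville identity for `F = evenSign d e * i * (d² - e²)`, symmetrised. -/
theorem sum_evenSign_eq_boundary (n : ℤ) :
    2 * ∑ v ∈ liouvilleTriples n,
        evenSign v.2.1 v.2.2 * ((v.2.1 * v.2.2 - 4 * v.1 ^ 2) * v.2.1) =
      2 * ∑ v ∈ liouvilleTriples n with v.2.2 = 2 * v.1 + v.2.1,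
        evenSign v.2.1 0 * ((v.1 + v.2.1) * v.2.1 ^ 2) -
      ∑ v ∈ liouvilleTriples n with v.2.1 = v.2.2 + 2 * v.1,
        evenSign v.2.1 v.2.2 * (v.1 * (v.2.1 ^ 2 - v.2.2 ^ 2)) := by
  have key := liouville_identity n (fun i d e => evenSign d e * (i * (d ^ 2 - e ^ 2)))
    (fun i d e => by simp only [evenSign_neg]; ring)
    (fun i d e => by simp only [evenSign_comm e d]; ring)
  simp only [evenSign_sub] at key
  -- `2 F(T v) - F v`, whose average over the four symmetries is the wanted summand
  set D : ℤ → ℤ → ℤ → ℤ := fun i d e => evenSign d e *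
    (2 * ((i + d) * (d ^ 2 - (e - 2 * i - d) ^ 2)) - i * (d ^ 2 - e ^ 2)) with hD
  set H : ℤ → ℤ → ℤ → ℤ := fun i d e => evenSign d e * ((d * e - 4 * i ^ 2) * d) with hH
  have h1 := (sum_liouvilleTriples_symm n D).1
  have h2 := (sum_liouvilleTriples_symm n D).2
  have h3 := (sum_liouvilleTriples_symm n fun i d e => D i e d).1
  have h4 := (sum_liouvilleTriples_symm n H).2
  have h5 : ∑ v ∈ liouvilleTriples n, D v.1 v.2.1 v.2.2 +
      ∑ v ∈ liouvilleTriples n, D (-v.1) v.2.1 v.2.2 +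
      ∑ v ∈ liouvilleTriples n, D v.1 v.2.2 v.2.1 +
      ∑ v ∈ liouvilleTriples n, D (-v.1) v.2.2 v.2.1 =
      4 * (∑ v ∈ liouvilleTriples n, H v.1 v.2.1 v.2.2 +
        ∑ v ∈ liouvilleTriples n, H v.1 v.2.2 v.2.1) := by
    simp only [← Finset.sum_add_distrib, Finset.mul_sum]
    refine Finset.sum_congr rfl fun v _ => ?_
    simp only [hD, hH, evenSign_comm v.2.2 v.2.1]
    ring
  have h6 : ∑ v ∈ liouvilleTriples n, D v.1 v.2.1 v.2.2 =
      2 * ∑ v ∈ liouvilleTriples n, evenSign v.2.1 v.2.2 *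
        ((v.1 + v.2.1) * (v.2.1 ^ 2 - (v.2.2 - 2 * v.1 - v.2.1) ^ 2)) -
      ∑ v ∈ liouvilleTriples n, evenSign v.2.1 v.2.2 * (v.1 * (v.2.1 ^ 2 - v.2.2 ^ 2)) := by
    simp only [Finset.mul_sum, ← Finset.sum_sub_distrib]
    refine Finset.sum_congr rfl fun v _ => ?_
    simp only [hD]
    ring
  have h7 : ∑ v ∈ liouvilleTriples n with v.2.2 = 2 * v.1 + v.2.1,
        evenSign v.2.1 0 * ((v.1 + v.2.1) * v.2.1 ^ 2) =
      ∑ v ∈ liouvilleTriples n with v.2.2 = 2 * v.1 + v.2.1,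
        evenSign v.2.1 0 * ((v.1 + v.2.1) * (v.2.1 ^ 2 - 0 ^ 2)) :=
    Finset.sum_congr rfl fun v _ => by ring
  rw [h7]
  linarith

theorem evenSign_zero_right (d : ℤ) : evenSign d 0 = evenSign d d := by simp [evenSign]

theorem four_mul_sum_evenSign (c : ℤ) (k : ℕ) :
    4 * ∑ d ∈ Finset.range (k + 1), evenSign d d * ((d : ℤ) * (c - d)) =
      evenSign k k * (c * (2 * k + 1) - 2 * k * (k + 1)) + c := by
  induction k with
  | zero => simp [evenSign]
  | succ k ih =>
    have h : evenSign k k = -evenSign (k + 1 : ℕ) (k + 1 : ℕ) := by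
      rcases Nat.even_or_odd k with h | h
      · simp [evenSign, h]
      · simp [evenSign, h, Nat.not_even_iff_odd.mpr h]
    rw [Finset.sum_range_succ, mul_add, ih, h]
    push_cast
    ring

theorem sum_Ioo_evenSign (s : ℕ) (hs : 0 < s) :
    ∑ d ∈ Finset.Ioo (0 : ℤ) (2 * s), evenSign d d * (d * (2 * s - d)) = s := by
  have h1 : ∑ d ∈ Finset.Ioo (0 : ℤ) (2 * s), evenSign d d * (d * (2 * s - d)) =
      ∑ d ∈ Finset.range (2 * s - 1 + 1), evenSign d d * ((d : ℤ) * (2 * s - d)) := by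
    rw [Finset.sum_range_succ']
    simp only [Nat.cast_zero, zero_mul, mul_zero, add_zero]
    refine Finset.sum_nbij' (fun d => (d - 1).toNat) (fun d => (d + 1 : ℕ)) ?_ ?_ ?_ ?_ ?_
    · intro d; simp only [Finset.mem_Ioo, Finset.mem_range]; omega
    · intro d; simp only [Finset.mem_Ioo, Finset.mem_range]; omega
    · intro d; simp only [Finset.mem_Ioo]; omega
    · intro d; simp
    · intro d h
      rw [Finset.mem_Ioo] at h
      rw [show (((d - 1).toNat + 1 : ℕ) : ℤ) = d by omega]
  have h2 := four_mul_sum_evenSign (2 * s) (2 * s - 1)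
  have h3 : ((2 * s - 1 : ℕ) : ℤ) = 2 * s - 1 := by omega
  have h4 : evenSign (2 * s - 1) (2 * s - 1) = 1 := by simp [evenSign]
  rw [← h1, h3, h4] at h2
  linarith

theorem sum_evenSign_of_sq (s : ℕ) (hs : 0 < s) :
    ∑ v ∈ liouvilleTriples ((s : ℤ) ^ 2),
        evenSign v.2.1 v.2.2 * ((v.2.1 * v.2.2 - 4 * v.1 ^ 2) * v.2.1) = (s : ℤ) ^ 2 := by
  have key := sum_evenSign_eq_boundary (s ^ 2)
  have hs' : (0 : ℤ) < s := by exact_mod_cast hs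
  have b1 : ∑ v ∈ liouvilleTriples ((s : ℤ) ^ 2) with v.2.2 = 2 * v.1 + v.2.1,
        evenSign v.2.1 0 * ((v.1 + v.2.1) * v.2.1 ^ 2) =
      ∑ d ∈ Finset.Ioo (0 : ℤ) (2 * s), evenSign d d * (s * d ^ 2) := by
    refine Finset.sum_nbij' (fun v => v.2.1) (fun d => ⟨s - d, d, 2 * s - d⟩) ?_ ?_ ?_ ?_ ?_
    · rintro ⟨i, d, e⟩ h
      simp only [Finset.mem_filter, mem_liouvilleTriples, Finset.mem_Ioo] at h ⊢
      obtain ⟨⟨h1, h2, h3⟩, h4⟩ := h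
      subst h4
      have : i + d = s := (sq_eq_sq₀ (by linarith) hs'.le).mp (by linarith)
      exact ⟨h1, by linarith⟩
    · intro d h
      simp only [Finset.mem_filter, mem_liouvilleTriples, Finset.mem_Ioo] at h ⊢
      exact ⟨⟨h.1, by linarith, by ring⟩, by ring⟩
    · rintro ⟨i, d, e⟩ h
      simp only [Finset.mem_filter, mem_liouvilleTriples] at h ⊢
      obtain ⟨⟨h1, h2, h3⟩, h4⟩ := h
      subst h4
      have : i + d = s := (sq_eq_sq₀ (by linarith) hs'.le).mp (by linarith)
      simp only [Sigma.mk.injEq, heq_eq_eq, Prod.mk.injEq]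
      exact ⟨by linarith, trivial, by linarith⟩
    · intro d _; rfl
    · rintro ⟨i, d, e⟩ h
      simp only [Finset.mem_filter, mem_liouvilleTriples] at h ⊢
      obtain ⟨⟨h1, h2, h3⟩, h4⟩ := h
      subst h4
      have : i + d = s := (sq_eq_sq₀ (by linarith) hs'.le).mp (by linarith)
      rw [this, evenSign_zero_right]
  have b2 : ∑ v ∈ liouvilleTriples ((s : ℤ) ^ 2) with v.2.1 = v.2.2 + 2 * v.1,
        evenSign v.2.1 v.2.2 * (v.1 * (v.2.1 ^ 2 - v.2.2 ^ 2)) =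
      ∑ d ∈ Finset.Ioo (0 : ℤ) (2 * s), evenSign d d * (4 * s * (d - s) ^ 2) := by
    refine Finset.sum_nbij' (fun v => v.2.1) (fun d => ⟨d - s, d, 2 * s - d⟩) ?_ ?_ ?_ ?_ ?_
    · rintro ⟨i, d, e⟩ h
      simp only [Finset.mem_filter, mem_liouvilleTriples, Finset.mem_Ioo] at h ⊢
      obtain ⟨⟨h1, h2, h3⟩, h4⟩ := h
      subst h4
      have : i + e = s := (sq_eq_sq₀ (by linarith) hs'.le).mp (by linarith)
      exact ⟨h1, by linarith⟩
    · intro d h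
      simp only [Finset.mem_filter, mem_liouvilleTriples, Finset.mem_Ioo] at h ⊢
      exact ⟨⟨h.1, by linarith, by ring⟩, by ring⟩
    · rintro ⟨i, d, e⟩ h
      simp only [Finset.mem_filter, mem_liouvilleTriples] at h ⊢
      obtain ⟨⟨h1, h2, h3⟩, h4⟩ := h
      subst h4
      have : i + e = s := (sq_eq_sq₀ (by linarith) hs'.le).mp (by linarith)
      simp only [Sigma.mk.injEq, heq_eq_eq, Prod.mk.injEq]
      exact ⟨by linarith, trivial, by linarith⟩
    · intro d _; rfl
    · rintro ⟨i, d, e⟩ h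
      simp only [Finset.mem_filter, mem_liouvilleTriples] at h ⊢
      obtain ⟨⟨h1, h2, h3⟩, h4⟩ := h
      subst h4
      have : i + e = s := (sq_eq_sq₀ (by linarith) hs'.le).mp (by linarith)
      have h5 : evenSign (e + 2 * i) e = evenSign (e + 2 * i) (e + 2 * i) := by
        simp [evenSign, Int.even_add]
      rw [h5, ← this]
      ring
  -- The reflection `d ↦ 2s - d` trades `d²` for the mean of `d²` and `(2s - d)²`.
  have b3 : ∑ d ∈ Finset.Ioo (0 : ℤ) (2 * s), evenSign d d * (s * d ^ 2) =
      ∑ d ∈ Finset.Ioo (0 : ℤ) (2 * s), evenSign d d * (s * (2 * s - d) ^ 2) := by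
    refine Finset.sum_nbij' (fun d => 2 * s - d) (fun d => 2 * s - d) ?_ ?_ ?_ ?_ ?_
    · intro d; simp only [Finset.mem_Ioo]; omega
    · intro d; simp only [Finset.mem_Ioo]; omega
    · intro d _; ring
    · intro d _; ring
    · intro d _
      have : evenSign (2 * s - d) (2 * s - d) = evenSign d d := by
        simp [evenSign, Int.even_sub]
      rw [this]; ring
  have b4 : ∑ d ∈ Finset.Ioo (0 : ℤ) (2 * s), evenSign d d * (s * d ^ 2) +
      ∑ d ∈ Finset.Ioo (0 : ℤ) (2 * s), evenSign d d * (s * (2 * s - d) ^ 2) -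
      ∑ d ∈ Finset.Ioo (0 : ℤ) (2 * s), evenSign d d * (4 * s * (d - s) ^ 2) =
      2 * s * ∑ d ∈ Finset.Ioo (0 : ℤ) (2 * s), evenSign d d * (d * (2 * s - d)) := by
    rw [← Finset.sum_add_distrib, ← Finset.sum_sub_distrib, Finset.mul_sum]
    exact Finset.sum_congr rfl fun d _ => by ring
  rw [sum_Ioo_evenSign s hs] at b4
  rw [b1, b2] at key
  linarith

theorem sum_evenSign_of_not_sq (n : ℤ) (hn : ¬ IsSquare n) :
    ∑ v ∈ liouvilleTriples n,
        evenSign v.2.1 v.2.2 * ((v.2.1 * v.2.2 - 4 * v.1 ^ 2) * v.2.1) = 0 := by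
  have key := sum_evenSign_eq_boundary n
  rw [Finset.filter_false_of_mem, Finset.filter_false_of_mem] at key
  · simpa using key
  · rintro ⟨i, d, e⟩ h h4
    simp only [mem_liouvilleTriples] at h h4
    exact hn ⟨i + e, by rw [← h.2.2, h4]; ring⟩
  · rintro ⟨i, d, e⟩ h h4
    simp only [mem_liouvilleTriples] at h h4
    exact hn ⟨i + d, by rw [← h.2.2, h4]; ring⟩

/-! ### The divisor sum and its recurrence -/

/-- The divisor sum equal to `r₄(k)`, with value `1` at `k = 0` and `0` at negative `k`. -/
noncomputable def fourSquareDivisorSum (k : ℤ) : ℤ :=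
  (if k = 0 then 1 else 0) + 8 * ∑ p ∈ factorPairs k, evenSign p.1 p.2 * p.1

theorem fourSquareDivisorSum_recurrence (n : ℤ) (hn : 0 < n) :
    ∑ i ∈ Finset.Icc (-n) n, (n - 5 * i ^ 2) * fourSquareDivisorSum (n - i ^ 2) = 0 := by
  have h1 : ∑ i ∈ Finset.Icc (-n) n, (n - 5 * i ^ 2) * fourSquareDivisorSum (n - i ^ 2) =
      ∑ i ∈ Finset.Icc (-n) n, (if n - i ^ 2 = 0 then n - 5 * i ^ 2 else 0) +
      8 * ∑ v ∈ liouvilleTriples n,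
        evenSign v.2.1 v.2.2 * ((v.2.1 * v.2.2 - 4 * v.1 ^ 2) * v.2.1) := by
    rw [liouvilleTriples, Finset.sum_sigma, Finset.mul_sum, ← Finset.sum_add_distrib]
    refine Finset.sum_congr rfl fun i _ => ?_
    rw [fourSquareDivisorSum, mul_add, mul_ite, mul_one, mul_zero, mul_left_comm, Finset.mul_sum]
    congr 2
    refine Finset.sum_congr rfl fun p hp => ?_
    have := (mem_factorPairs.mp hp).2.2
    rw [show n - 5 * i ^ 2 = p.1 * p.2 - 4 * i ^ 2 by linarith]
    ring
  rw [h1]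
  by_cases hsq : IsSquare n
  · obtain ⟨r, hr⟩ := hsq
    obtain ⟨s, hs⟩ : ∃ s : ℕ, n = (s : ℤ) ^ 2 := ⟨r.natAbs, by rw [Int.natAbs_sq, hr, sq]⟩
    have hs0 : 0 < s := by
      rcases Nat.eq_zero_or_pos s with h | h
      · subst h; simp at hs; omega
      · exact h
    subst hs
    rw [sum_evenSign_of_sq s hs0, ← Finset.sum_filter]
    have h2 : (Finset.Icc (-(s : ℤ) ^ 2) (s ^ 2)).filter (fun i : ℤ => (s : ℤ) ^ 2 - i ^ 2 = 0) =
        {(s : ℤ), -(s : ℤ)} := by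
      ext i
      simp only [Finset.mem_filter, Finset.mem_insert, Finset.mem_singleton]
      rw [sub_eq_zero, eq_comm, sq_eq_sq_iff_eq_or_eq_neg]
      constructor
      · exact fun h => h.2
      · intro h
        refine ⟨mem_Icc_neg_self_of_sq_le ?_, h⟩
        rcases h with rfl | rfl <;> simp
    rw [h2, Finset.sum_pair (by omega)]
    ring
  · rw [sum_evenSign_of_not_sq n hsq, Finset.sum_eq_zero]
    · rfl
    · intro i _
      rw [if_neg]
      intro h
      exact hsq ⟨i, by linarith⟩

theorem sum_factorPairs_fst (N : ℕ) (f : ℤ → ℤ) :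
    ∑ p ∈ factorPairs N, f p.1 = ∑ d ∈ N.divisors, f d := by
  rcases Nat.eq_zero_or_pos N with rfl | hN
  · simp [factorPairs]
  refine Finset.sum_nbij' (fun p => p.1.toNat) (fun d => ((d : ℤ), ((N / d : ℕ) : ℤ)))
    ?_ ?_ ?_ ?_ ?_
  · rintro ⟨d, e⟩ h
    obtain ⟨h1 : 0 < d, h2 : 0 < e, h3 : d * e = N⟩ := mem_factorPairs.mp h
    lift d to ℕ using h1.le
    lift e to ℕ using h2.le
    rw [Nat.mem_divisors]
    exact ⟨⟨e, by exact_mod_cast h3.symm⟩, hN.ne'⟩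
  · intro d h
    have hd := Nat.dvd_of_mem_divisors h
    rw [mem_factorPairs]
    simp only
    refine ⟨?_, ?_, ?_⟩
    · exact_mod_cast Nat.pos_of_mem_divisors h
    · exact_mod_cast Nat.div_pos (Nat.le_of_dvd hN hd) (Nat.pos_of_mem_divisors h)
    · exact_mod_cast Nat.mul_div_cancel' hd
  · rintro ⟨d, e⟩ h
    obtain ⟨h1 : 0 < d, h2 : 0 < e, h3 : d * e = N⟩ := mem_factorPairs.mp h
    lift d to ℕ using h1.le
    lift e to ℕ using h2.le
    have h4 : d * e = N := by exact_mod_cast h3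
    have h5 : 0 < d := by exact_mod_cast h1
    simp [← h4, Nat.mul_div_cancel_left e h5]
  · intro d _
    simp
  · rintro ⟨d, e⟩ h
    obtain ⟨h1 : 0 < d, h2 : 0 < e, h3 : d * e = N⟩ := mem_factorPairs.mp h
    rw [Int.toNat_of_nonneg h1.le]

theorem fourSquareDivisorSum_of_odd (N : ℕ) (hN : Odd N) :
    fourSquareDivisorSum N = (8 * ∑ d ∈ N.divisors, d : ℕ) := by
  have h0 : (N : ℤ) ≠ 0 := by exact_mod_cast hN.pos.ne'
  have h1 : ∑ p ∈ factorPairs N, evenSign p.1 p.2 * p.1 = ∑ p ∈ factorPairs N, p.1 := by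
    refine Finset.sum_congr rfl fun p hp => ?_
    have h2 : Odd (p.1 * p.2) := by
      rw [(mem_factorPairs.mp hp).2.2]
      exact_mod_cast hN
    have h3 : ¬ (Even p.1 ∧ Even p.2) := fun h =>
      Int.not_even_iff_odd.mpr (Int.odd_mul.mp h2).1 h.1
    rw [evenSign, if_neg h3, one_mul]
  rw [fourSquareDivisorSum, if_neg h0, h1, sum_factorPairs_fst N fun d => d]
  push_cast
  ring

theorem fourSquareDivisorSum_of_even (N : ℕ) (h0 : N ≠ 0) (hN : Even N) :
    fourSquareDivisorSum N = (24 * ∑ d ∈ N.divisors with d % 2 = 1, d : ℕ) := by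
  -- Moving a factor `2` across the factorisation `(d, e) ↦ (2d, e / 2)`.
  have h1 : ∑ p ∈ factorPairs N with Even p.2, 2 * p.1 =
      ∑ p ∈ factorPairs N with Even p.1, p.1 := by
    refine Finset.sum_nbij' (fun p => (2 * p.1, p.2 / 2)) (fun p => (p.1 / 2, 2 * p.2))
      ?_ ?_ ?_ ?_ ?_
    · rintro ⟨d, e⟩ h
      simp only [Finset.mem_filter, mem_factorPairs] at h ⊢
      obtain ⟨⟨h1, h2, h3⟩, k, rfl⟩ := h
      rw [show (k + k) / 2 = k by omega]
      exact ⟨⟨by linarith, by linarith, by linarith⟩, even_two_mul d⟩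
    · rintro ⟨d, e⟩ h
      simp only [Finset.mem_filter, mem_factorPairs] at h ⊢
      obtain ⟨⟨h1, h2, h3⟩, k, rfl⟩ := h
      rw [show (k + k) / 2 = k by omega]
      exact ⟨⟨by linarith, by linarith, by linarith⟩, even_two_mul e⟩
    · rintro ⟨d, e⟩ h
      obtain ⟨-, k, hk⟩ := Finset.mem_filter.mp h
      simp only [Prod.mk.injEq] at hk ⊢
      omega
    · rintro ⟨d, e⟩ h
      obtain ⟨-, k, hk⟩ := Finset.mem_filter.mp h
      simp only [Prod.mk.injEq] at hk ⊢
      omega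
    · intro p _
      rfl
  have h2 : ∑ p ∈ factorPairs N, evenSign p.1 p.2 * p.1 =
      3 * ∑ p ∈ factorPairs N, (if Odd p.1 then p.1 else 0) +
      (∑ p ∈ factorPairs N with Even p.1, p.1 - ∑ p ∈ factorPairs N with Even p.2, 2 * p.1) := by
    rw [Finset.sum_filter, Finset.sum_filter, Finset.mul_sum, ← Finset.sum_sub_distrib,
      ← Finset.sum_add_distrib]
    refine Finset.sum_congr rfl fun p hp => ?_
    have h3 : Even (p.1 * p.2) := by
      rw [(mem_factorPairs.mp hp).2.2]
      exact_mod_cast hN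
    rw [Int.even_mul] at h3
    simp only [evenSign, ← Int.not_even_iff_odd]
    by_cases h4 : Even p.1 <;> by_cases h5 : Even p.2 <;> simp [h4, h5] <;> first | ring1 | tauto
  have h3 : (N : ℤ) ≠ 0 := by exact_mod_cast h0
  rw [fourSquareDivisorSum, if_neg h3, h2, h1,
    sum_factorPairs_fst N fun d => if Odd d then d else 0]
  simp only [← Nat.odd_iff, Int.odd_coe_nat, ← Finset.sum_filter]
  push_cast
  ring

/-! ### Jacobi's four-square theorem -/

/-- The integer `N`-tuples with sum of squares `n`, as a finite set. -/
noncomputable def squareTuples (N : ℕ) (n : ℤ) : Finset (Fin N → ℤ) :=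
  (Fintype.piFinset fun _ => Finset.Icc (-n) n).filter fun x => ∑ k, x k ^ 2 = n

theorem mem_squareTuples {N : ℕ} {n : ℤ} {x : Fin N → ℤ} :
    x ∈ squareTuples N n ↔ ∑ k, x k ^ 2 = n := by
  simp only [squareTuples, Finset.mem_filter, Fintype.mem_piFinset, and_iff_right_iff_imp]
  rintro rfl k
  exact mem_Icc_neg_self_of_sq_le
    (Finset.single_le_sum (f := fun k => x k ^ 2) (fun j _ => sq_nonneg (x j)) (Finset.mem_univ k))

theorem squareReps_eq_card (N n : ℕ) : squareReps N n = (squareTuples N n).card := by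
  rw [squareReps, ← Set.ncard_coe_finset]
  congr 1
  ext x
  simp [mem_squareTuples]

/-- The coefficient form of `θ · (θ⁴)' = 4 θ' · θ⁴`: it holds since all coordinates of a
representation by five squares play the same role. -/
theorem card_squareTuples_recurrence (n : ℤ) :
    ∑ i ∈ Finset.Icc (-n) n, (n - 5 * i ^ 2) * ((squareTuples 4 (n - i ^ 2)).card : ℤ) = 0 := by
  have h1 : ∑ i ∈ Finset.Icc (-n) n, (n - 5 * i ^ 2) * ((squareTuples 4 (n - i ^ 2)).card : ℤ) =
      ∑ x ∈ squareTuples 5 n, (n - 5 * x 0 ^ 2) := by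
    have h2 : ∀ i ∈ Finset.Icc (-n) n,
        (n - 5 * i ^ 2) * ((squareTuples 4 (n - i ^ 2)).card : ℤ) =
          ∑ _y ∈ squareTuples 4 (n - i ^ 2), (n - 5 * i ^ 2) := fun i _ => by
      rw [Finset.sum_const, nsmul_eq_mul, mul_comm]
    rw [Finset.sum_congr rfl h2, Finset.sum_sigma']
    refine Finset.sum_nbij' (fun v => Fin.cons v.1 v.2) (fun x => ⟨x 0, Fin.tail x⟩) ?_ ?_ ?_ ?_ ?_
    · rintro ⟨i, y⟩ h
      simp only [Finset.mem_sigma, mem_squareTuples] at h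
      simp only [mem_squareTuples, Fin.sum_univ_succ (n := 4), Fin.cons_zero, Fin.cons_succ, h.2]
      ring
    · intro x h
      rw [mem_squareTuples, Fin.sum_univ_succ] at h
      simp only [Finset.mem_sigma, mem_squareTuples, Fin.tail]
      have : 0 ≤ ∑ k : Fin 4, x k.succ ^ 2 := Finset.sum_nonneg fun k _ => sq_nonneg _
      exact ⟨mem_Icc_neg_self_of_sq_le (by linarith), by linarith⟩
    · rintro ⟨i, y⟩ _
      simp
    · intro x _
      simp
    · rintro ⟨i, y⟩ _
      simp
  have h2 : ∀ k : Fin 5, ∑ x ∈ squareTuples 5 n, x k ^ 2 = ∑ x ∈ squareTuples 5 n, x 0 ^ 2 := by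
    intro k
    refine Finset.sum_nbij' (fun x => x ∘ Equiv.swap 0 k) (fun x => x ∘ Equiv.swap 0 k)
      ?_ ?_ ?_ ?_ ?_
    · intro x h
      rw [mem_squareTuples] at h ⊢
      exact (Equiv.sum_comp (Equiv.swap 0 k) fun j => x j ^ 2).trans h
    · intro x h
      rw [mem_squareTuples] at h ⊢
      exact (Equiv.sum_comp (Equiv.swap 0 k) fun j => x j ^ 2).trans h
    · intro x _
      funext j
      simp
    · intro x _
      funext j
      simp
    · intro x _
      simp
  have h3 : ∑ x ∈ squareTuples 5 n, n = ∑ k : Fin 5, ∑ x ∈ squareTuples 5 n, x k ^ 2 := by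
    rw [Finset.sum_comm]
    exact Finset.sum_congr rfl fun x hx => (mem_squareTuples.mp hx).symm
  rw [Finset.sum_congr rfl fun k _ => h2 k] at h3
  rw [h1, Finset.sum_sub_distrib, ← Finset.mul_sum, h3]
  simp

/-- The recurrence expresses `n G(n)` by earlier values, so it determines `G` from `G 0`. -/
theorem eq_of_recurrence {G H : ℤ → ℤ}
    (hG : ∀ n > 0, ∑ i ∈ Finset.Icc (-n) n, (n - 5 * i ^ 2) * G (n - i ^ 2) = 0)
    (hH : ∀ n > 0, ∑ i ∈ Finset.Icc (-n) n, (n - 5 * i ^ 2) * H (n - i ^ 2) = 0)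
    (hneg : ∀ n < 0, G n = H n) (hzero : G 0 = H 0) (n : ℕ) : G n = H n := by
  induction n using Nat.strong_induction_on with
  | _ n ih =>
    rcases Nat.eq_zero_or_pos n with rfl | hn
    · exact hzero
    have hn' : (0 : ℤ) < n := by exact_mod_cast hn
    have h0 : (0 : ℤ) ∈ Finset.Icc (-(n : ℤ)) n := by simp
    have eG := hG n hn'
    have eH := hH n hn'
    rw [← Finset.add_sum_erase _ _ h0] at eG eH
    have h1 : ∑ i ∈ (Finset.Icc (-(n : ℤ)) n).erase 0, (n - 5 * i ^ 2) * G (n - i ^ 2) =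
        ∑ i ∈ (Finset.Icc (-(n : ℤ)) n).erase 0, (n - 5 * i ^ 2) * H (n - i ^ 2) := by
      refine Finset.sum_congr rfl fun i hi => ?_
      have hi' : 0 < i ^ 2 := by
        have := (Finset.mem_erase.mp hi).1
        positivity
      congr 1
      rcases lt_or_ge ((n : ℤ) - i ^ 2) 0 with h | h
      · exact hneg _ h
      · have h2 := ih ((n : ℤ) - i ^ 2).toNat (by omega)
        rwa [Int.toNat_of_nonneg h] at h2
    rw [h1] at eG
    have h2 : (n : ℤ) * G n = n * H n := by
      have h3 := add_right_cancel (eG.trans eH.symm)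
      simpa only [ne_eq, OfNat.ofNat_ne_zero, not_false_eq_true, zero_pow, mul_zero, sub_zero]
        using h3
    exact mul_left_cancel₀ hn'.ne' h2

theorem card_squareTuples_of_neg (N : ℕ) (n : ℤ) (hn : n < 0) : (squareTuples N n).card = 0 := by
  rw [Finset.card_eq_zero, Finset.eq_empty_iff_forall_notMem]
  intro x h
  rw [mem_squareTuples] at h
  have : 0 ≤ ∑ k, x k ^ 2 := Finset.sum_nonneg fun k _ => sq_nonneg _
  linarith

theorem squareReps_zero (N : ℕ) : squareReps N 0 = 1 := by
  rw [squareReps, Set.ncard_eq_one]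
  refine ⟨0, ?_⟩
  ext x
  simp only [Nat.cast_zero, Set.mem_ofPred_eq, Set.mem_singleton_iff]
  rw [Finset.sum_eq_zero_iff_of_nonneg fun k _ => sq_nonneg _]
  simp [funext_iff]

/-- Jacobi's four-square theorem. -/
theorem squareReps_four (n : ℕ) : (squareReps 4 n : ℤ) = fourSquareDivisorSum n := by
  rw [squareReps_eq_card]
  refine eq_of_recurrence (G := fun n => ((squareTuples 4 n).card : ℤ))
    (fun n _ => card_squareTuples_recurrence n) fourSquareDivisorSum_recurrence ?_ ?_ n
  · intro n hn
    have h : factorPairs n = ∅ := by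
      simp [factorPairs, Finset.Icc_eq_empty (show ¬ (1 : ℤ) ≤ n by omega)]
    simp [card_squareTuples_of_neg 4 n hn, fourSquareDivisorSum, hn.ne, h]
  · have := squareReps_zero 4
    rw [squareReps_eq_card, Nat.cast_zero] at this
    simp [this, fourSquareDivisorSum, factorPairs]

theorem squareReps_four_of_odd (N : ℕ) (hN : Odd N) :
    squareReps 4 N = 8 * ∑ d ∈ N.divisors, d := by
  exact_mod_cast (squareReps_four N).trans (fourSquareDivisorSum_of_odd N hN)

theorem squareReps_four_of_even (N : ℕ) (h0 : N ≠ 0) (hN : Even N) :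
    squareReps 4 N = 24 * ∑ d ∈ N.divisors with d % 2 = 1, d := by
  exact_mod_cast (squareReps_four N).trans (fourSquareDivisorSum_of_even N h0 hN)

/-! ### Sums of four odd squares -/

/-- A sum of four squares divisible by `4` has all its terms even or all its terms odd; the former
representations of `4 N` are the doubles of those of `N`. -/
theorem squareReps_four_four_mul (N : ℕ) :
    squareReps 4 (4 * N) = squareReps 4 N +
      {x : Fin 4 → ℤ | (∀ k, Odd (x k)) ∧ ∑ k, x k ^ 2 = 4 * (N : ℤ)}.ncard := by
  have h1 : squareReps 4 N =
      {x : Fin 4 → ℤ | (∀ k, Even (x k)) ∧ ∑ k, x k ^ 2 = 4 * (N : ℤ)}.ncard := by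
    refine Set.ncard_congr (fun x _ k => 2 * x k) ?_ ?_ ?_
    · intro x hx
      simp only [Set.mem_ofPred_eq] at hx ⊢
      refine ⟨fun k => even_two_mul _, ?_⟩
      simp only [mul_pow, ← Finset.mul_sum, hx]
      norm_num
    · intro x y _ _ h
      funext k
      simpa using congrFun h k
    · rintro x ⟨he, hx⟩
      choose y hy using fun k => (he k).two_dvd
      refine ⟨y, ?_, (funext hy).symm⟩
      simp only [hy, mul_pow, ← Finset.mul_sum] at hx
      simp only [Set.mem_ofPred_eq]
      linarith
  have hfin : ∀ P : (Fin 4 → ℤ) → Prop,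
      {x : Fin 4 → ℤ | P x ∧ ∑ k, x k ^ 2 = 4 * (N : ℤ)}.Finite := fun P =>
    (squareTuples 4 (4 * N)).finite_toSet.subset fun x hx => by simpa [mem_squareTuples] using hx.2
  rw [h1, ← Set.ncard_union_eq _ (hfin _) (hfin _), squareReps]
  · congr 1
    ext x
    simp only [Set.mem_ofPred_eq, Set.mem_union, ← or_and_right, Nat.cast_mul, Nat.cast_ofNat,
      iff_and_self]
    intro h
    rw [Fin.sum_univ_four] at h
    have key : ∀ a : ℤ, (Even a ∧ a ^ 2 % 4 = 0) ∨ (Odd a ∧ a ^ 2 % 4 = 1) := fun a =>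
      a.even_or_odd.imp (fun h => ⟨h, Int.emod_eq_zero_of_dvd (by
        simpa using pow_dvd_pow_of_dvd h.two_dvd 2)⟩) fun h => ⟨h, Int.sq_mod_four_eq_one_of_odd h⟩
    simp only [Fin.forall_fin_succ, Fin.succ_zero_eq_one, Fin.succ_one_eq_two,
      IsEmpty.forall_iff, and_true]
    rcases key (x 0) with ⟨h0, k0⟩ | ⟨h0, k0⟩ <;> rcases key (x 1) with ⟨h1, k1⟩ | ⟨h1, k1⟩ <;>
      rcases key (x 2) with ⟨h2, k2⟩ | ⟨h2, k2⟩ <;> rcases key (x 3) with ⟨h3, k3⟩ | ⟨h3, k3⟩ <;>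
      first | exact Or.inl ⟨h0, h1, h2, h3⟩ | exact Or.inr ⟨h0, h1, h2, h3⟩ | omega
  · rw [Set.disjoint_left]
    rintro x ⟨h, -⟩ ⟨h', -⟩
    exact Int.not_even_iff_odd.mpr (h' 0) (h 0)

theorem ncard_odd_four_squares (N : ℕ) (hN : Odd N) :
    {x : Fin 4 → ℤ | (∀ k, Odd (x k)) ∧ ∑ k, x k ^ 2 = 4 * (N : ℤ)}.ncard =
      16 * ∑ d ∈ N.divisors, d := by
  have h1 := squareReps_four_four_mul N
  have h2 : (4 * N).divisors.filter (fun d => d % 2 = 1) = N.divisors := by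
    ext d
    simp only [Finset.mem_filter, Nat.mem_divisors, ← Nat.odd_iff]
    constructor
    · rintro ⟨⟨h, -⟩, hd⟩
      exact ⟨(Nat.Coprime.pow_right 2 (Nat.coprime_two_right.mpr hd)).dvd_of_dvd_mul_left h,
        hN.pos.ne'⟩
    · rintro ⟨h, h0⟩
      exact ⟨⟨h.mul_left 4, by positivity⟩, hN.of_dvd_nat h⟩
  rw [squareReps_four_of_odd N hN, squareReps_four_of_even (4 * N) (by have := hN.pos; omega)
    (by simp [show Even 4 by decide]), h2] at h1
  omega

/-! ### Triangular numbers -/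

theorem triangularReps_even (p N n : ℕ) :
    triangularReps (2 * p) N n = squareReps N (2 * n + N * p ^ 2) := by
  -- Completing the square: `2 t_{2p}(x) + p² = (x + p)²`.
  have hiff : ∀ x : Fin N → ℤ, ∑ k, mTriangular (2 * p) (x k) = (n : ℚ) ↔
      ∑ k, (x k + (p : ℤ)) ^ 2 = ((2 * n + N * p ^ 2 : ℕ) : ℤ) := by
    intro x
    have h : ((∑ k, (x k + (p : ℤ)) ^ 2 : ℤ) : ℚ) =
        2 * ∑ k, mTriangular (2 * p) (x k) + N * p ^ 2 := by
      have h1 : (N * p ^ 2 : ℚ) = ∑ _k : Fin N, (p : ℚ) ^ 2 := by simp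
      rw [h1, Finset.mul_sum, ← Finset.sum_add_distrib]
      push_cast
      refine Finset.sum_congr rfl fun k _ => ?_
      simp only [mTriangular]
      push_cast
      ring
    rw [← Int.cast_inj (α := ℚ), h]
    push_cast
    constructor <;> intro h <;> linarith
  refine Set.ncard_congr (fun x _ k => x k + p) ?_ ?_ ?_
  · intro x hx
    exact (hiff x).mp hx
  · intro x y _ _ h
    funext k
    simpa using congrFun h k
  · intro y hy
    have h : (fun k => y k - (p : ℤ) + p) = y := funext fun k => sub_add_cancel _ _
    refine ⟨fun k => y k - p, (hiff _).mpr ?_, h⟩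
    simpa using hy

/-- For odd `m`, every `m`-triangular number is attained exactly twice, at `x` and `-m - x`. -/
theorem triangularReps_odd_eq_two_pow_mul (p N n : ℕ) :
    triangularReps (2 * p + 1) N n = 2 ^ N * triangularValueReps (2 * p + 1) N n := by
  have h2 : (Set.univ : Set (Fin N → Bool)).ncard = 2 ^ N := by
    simp [Set.ncard_univ]
  have heq : ∀ x y : ℤ, mTriangular (2 * p + 1) x = mTriangular (2 * p + 1) y →
      x = y ∨ x = -(2 * p + 1) - y := by
    intro x y h
    have h3 : (x - y) * (x + y + (2 * p + 1)) = 0 := by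
      have : ((x - y) * (x + y + (2 * p + 1)) : ℚ) = 0 := by
        simp only [mTriangular] at h
        push_cast at h
        linarith
      exact_mod_cast this
    rcases mul_eq_zero.mp h3 with h | h
    · left; linarith
    · right; linarith
  have hrefl : ∀ x : ℤ, mTriangular (2 * p + 1) (-(2 * p + 1) - x) =
      mTriangular (2 * p + 1) x := by
    intro x
    simp only [mTriangular]
    push_cast
    ring
  rw [mul_comm (2 ^ N), ← h2, triangularValueReps, ← Set.ncard_prod]
  -- The boolean records on which side of the axis of symmetry `-m / 2` the argument lies.
  refine Set.ncard_congr
    (fun x _ => (fun k => mTriangular (2 * p + 1) (x k), fun k => decide (-(p : ℤ) ≤ x k)))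
    ?_ ?_ ?_
  · intro x hx
    exact ⟨⟨fun k => ⟨x k, rfl⟩, hx⟩, Set.mem_univ _⟩
  · intro x y _ _ h
    funext k
    have h1 := congrFun (Prod.mk.inj h).1 k
    have h3 := congrFun (Prod.mk.inj h).2 k
    simp only [decide_eq_decide] at h3
    rcases heq _ _ h1 with h | h
    · exact h
    · omega
  · rintro ⟨T, b⟩ ⟨⟨hT, hsum⟩, -⟩
    choose y hy using hT
    have hx : ∀ k, ∃ z : ℤ, mTriangular (2 * p + 1) z = T k ∧ decide (-(p : ℤ) ≤ z) = b k := by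
      intro k
      by_cases h : decide (-(p : ℤ) ≤ y k) = b k
      · exact ⟨y k, hy k, h⟩
      · refine ⟨-(2 * p + 1) - y k, by rw [hrefl, hy], ?_⟩
        cases hb : b k
        · simp only [hb, decide_eq_false_iff_not] at h ⊢
          omega
        · simp only [hb, decide_eq_true_eq] at h ⊢
          omega
    choose x hx1 hx2 using hx
    refine ⟨x, ?_, Prod.ext (funext hx1) (funext hx2)⟩
    simp only [Set.mem_ofPred_eq, hx1]
    exact hsum

theorem triangularReps_odd (p n : ℕ) :
    triangularReps (2 * p + 1) 4 n =
      16 * ∑ d ∈ (2 * n + 4 * p * (p + 1) + 1).divisors, d := by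
  rw [← ncard_odd_four_squares _ ⟨n + 2 * p * (p + 1), by ring⟩]
  -- Completing the square: `8 t_m(x) + m² = (2x + m)²`.
  have hiff : ∀ x : Fin 4 → ℤ, ∑ k, mTriangular (2 * p + 1) (x k) = (n : ℚ) ↔
      ∑ k, (2 * x k + (2 * p + 1)) ^ 2 = 4 * ((2 * n + 4 * p * (p + 1) + 1 : ℕ) : ℤ) := by
    intro x
    rw [← Int.cast_inj (α := ℚ)]
    simp only [Fin.sum_univ_four, mTriangular]
    push_cast
    constructor <;> intro h <;> linarith
  refine Set.ncard_congr (fun x _ k => 2 * x k + (2 * p + 1)) ?_ ?_ ?_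
  · intro x hx
    exact ⟨fun k => ⟨x k + p, by ring⟩, (hiff x).mp hx⟩
  · intro x y _ _ h
    funext k
    have := congrFun h k
    omega
  · rintro y ⟨hodd, hy⟩
    choose z hz using hodd
    have h : (fun k => 2 * (z k - p) + (2 * (p : ℤ) + 1)) = y := by
      funext k
      rw [hz k]
      ring
    refine ⟨fun k => z k - p, ?_, h⟩
    rw [← h] at hy
    exact (hiff _).mpr hy

theorem theorem10 :
    (∀ p n : ℕ, triangularReps (2 * p) 4 n = squareReps 4 (2 * n + 4 * p ^ 2)) ∧
    (squareReps 4 0 = 1 ∧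
      (∀ N : ℕ, Odd N → squareReps 4 N = 8 * ∑ d ∈ N.divisors, d) ∧
      (∀ N : ℕ, N ≠ 0 → Even N →
        squareReps 4 N = 24 * ∑ d ∈ N.divisors with d % 2 = 1, d)) ∧
    (∀ p n : ℕ,
      triangularValueReps (2 * p + 1) 4 n =
        ArithmeticFunction.sigma 1 (2 * n + 4 * p * (p + 1) + 1) ∧
      triangularReps (2 * p + 1) 4 n =
        16 * ArithmeticFunction.sigma 1 (2 * n + 4 * p * (p + 1) + 1)) := by
  refine ⟨fun p n => triangularReps_even p 4 n,
    ⟨squareReps_zero 4, squareReps_four_of_odd, squareReps_four_of_even⟩, fun p n => ?_⟩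
  have h1 := triangularReps_odd p n
  have h2 := triangularReps_odd_eq_two_pow_mul p 4 n
  rw [ArithmeticFunction.sigma_one_apply]
  exact ⟨by omega, h1⟩
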